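/- Let $\mathcal X$ be a connected, second countable (Hausdorff, finite-dimensional, boundaryless) $C^\infty$ manifold with a Finsler structure $F:T\mathcal X\to[0,\infty)$, i.e. $F$ is continuous, $C^\infty$ off the zero section, and each $F(x,\cdot)$ is a Minkowski norm on $T_x\mathcal X$: it satisfies $F(x,\lambda v)=\lambda F(x,v)$ for $\lambda\ge 0$, is continuous on $T_x\mathcal X$ and $C^\infty$ on $T_x\mathcal X\setminus\{0\}$, and $\tfrac12 d^2[F(x,\cdot)^2](v)$ is positive definite for every $v\neq0$. Let $$d(x,y)=\inf\Big\{\int_a^b F(\sigma(t),\dot\sigma(t))\,dt \;:\; \sigma:[a,b]\to\mathcal X \text{ piecewise } C^1,\ \sigma(a)=x,\ \sigma(b)=y\Big\}$$ be the Finsler distance, and suppose that $(\mathcal X,d)$ is forward complete: every sequence $(x_n)$ such that for each $\varepsilon>0$ there is $n_0$ with $d(x_n,x_m)<\varepsilon$ for all $n_0\le n\le m$ converges in the forward topology, which is generated by the balls $\{z: d(x,z)<r\}$, $r>0$. For $f:\mathcal X\to\mathbb R$ let $\|f|_S=\inf\{L>0:\max\{f(y)-f(x),0\}\le L\,d(x,y)\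 \text{for all } x,y\in\mathcal X\}$ (with $\inf\emptyset=\infty$). Let $SC_b^1(\mathcal X)_+$ be the cone of all bounded nonnegative $C^1$ functions $f:\mathcal X\to\mathbb R$ with $\|f|_S<\infty$. Let $\mathcal A(\mathcal X)$ be the linear span of $SC_b^1(\mathcal X)_+$ in $\mathbb R^{\mathcal X}$, with the extended asymmetric hemi-norm $\|f|=\max\{\|f\|_\infty,\|f|_S\}$ if $f\in SC_b^1(\mathcal X)_+$ and $\|f|=+\infty$ otherwise. Let $\mathcal A(\mathcal X)^*$ be the cone of all linear $\varphi:\mathcal A(\mathcal X)\to\mathbb R$ that are upper semicontinuous for the forward topology generated by the balls $\{g:\|g-f|<r\}$, $f\in\mathcal A(\mathcal X)$, $r>0$, with the dual norm $\|\varphi|^*=\sup\{\varphi(f): f\in\mathcal A(\mathcal X),\ \|f|\le 1\}$. For $x\in\mathcal X$ let $\delta_x(f)=f(x)$ for $f\in\mathcal A(\mathcal X)$. Then for all $x,y\in\mathcal X$, $\delta_y-\delta_x\in\mathcal A(\mathcal X)^*$ and $$\min\{d(x,y),1\}\le \|\delta_y-\delta_x|^*\le d(x,y).$$ -/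

import Mathlib

open scoped Manifold ContDiff ENNReal Topology

noncomputable section

namespace Finsler

section QuasiMetric

/-- The forward topology of a quasi-metric (possibly hemi-, possibly extended) `d`,
generated by the forward balls `{y | d x y < r}`, `r > 0`. -/
@[reducible] def forwardTopology {X R : Type*} [LT R] [Zero R] (d : X → X → R) : TopologicalSpace X :=
  TopologicalSpace.generateFrom {B | ∃ x : X, ∃ r : R, 0 < r ∧ B = {y | d x y < r}}

def IsForwardCauchy {X : Type*} (d : X → X → ℝ) (u : ℕ → X) : Prop :=
  ∀ ε > 0, ∃ n₀ : ℕ, ∀ n m : ℕ, n₀ ≤ n → n ≤ m → d (u n) (u m) < ε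

/-- Every forward-Cauchy sequence converges in the forward topology. -/
def IsForwardComplete {X : Type*} (d : X → X → ℝ) : Prop :=
  ∀ u : ℕ → X, IsForwardCauchy d u →
    ∃ x : X, Filter.Tendsto u Filter.atTop (@nhds X (forwardTopology d) x)

/-- The quasi-hemi-metric `d_u(s,t) = max {t - s, 0}` of the real line. -/
def realQuasiDist (s t : ℝ) : ℝ := max (t - s) 0

/-- `f : (X, d) → (ℝ, d_u)` is semi-Lipschitz with constant `L`. -/
def SemiLipschitzWith {X : Type*} (d : X → X → ℝ) (L : ℝ) (f : X → ℝ) : Prop :=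
  ∀ x y : X, realQuasiDist (f x) (f y) ≤ L * d x y

def IsSemiLipschitz {X : Type*} (d : X → X → ℝ) (f : X → ℝ) : Prop :=
  ∃ L : ℝ, 0 ≤ L ∧ SemiLipschitzWith d L f

/-- The semi-Lipschitz constant `‖f|_S` of a semi-Lipschitz function. -/
def semiLipConst {X : Type*} (d : X → X → ℝ) (f : X → ℝ) : ℝ :=
  sInf {L : ℝ | 0 < L ∧ SemiLipschitzWith d L f}

/-- The uniform norm `‖f‖_∞` of a bounded function. -/
def supNorm {X : Type*} (f : X → ℝ) : ℝ := ⨆ x : X, |f x|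

end QuasiMetric

section Manifold

variable {E : Type*} [NormedAddCommGroup E] [NormedSpace ℝ E]

/-- Minkowski norms on a (finite-dimensional) real vector space. -/
structure IsMinkowskiNorm (F : E → ℝ) : Prop where
  nonneg : ∀ v : E, 0 ≤ F v
  pos_homogeneous : ∀ (c : ℝ) (v : E), 0 ≤ c → F (c • v) = c * F v
  continuous : Continuous F
  smooth : ContDiffOn ℝ ∞ F {v : E | v ≠ 0}
  posDef : ∀ v : E, v ≠ 0 → ∀ w : E, w ≠ 0 →
    0 < (1 / 2 : ℝ) * fderiv ℝ (fderiv ℝ fun u : E => F u ^ 2) v w w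

variable (E) in
/-- Finsler structures on a manifold `X` modelled on `E`. Each tangent space of `X` is, as a
vector space, a copy of `E`, so that the notion of Minkowski norm applies to it. -/
structure FinslerStructure (X : Type*) [TopologicalSpace X] [ChartedSpace E X]
    [IsManifold 𝓘(ℝ, E) ∞ X] where
  toFun : ∀ x : X, TangentSpace 𝓘(ℝ, E) x → ℝ
  continuous : Continuous fun p : TangentBundle 𝓘(ℝ, E) X => toFun p.proj p.snd
  smooth : ContMDiffOn 𝓘(ℝ, E).tangent 𝓘(ℝ, ℝ) ∞
    (fun p : TangentBundle 𝓘(ℝ, E) X => toFun p.proj p.snd) {p | p.snd ≠ 0}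
  minkowski : ∀ x : X, IsMinkowskiNorm (E := E) (toFun x)

variable {X : Type*} [TopologicalSpace X] [ChartedSpace E X]

variable (E) in
/-- `σ` restricted to `[a,b]` is a piecewise `C¹` path: `C¹` on each closed subinterval of some
partition `a = t₀ ≤ t₁ ≤ … ≤ t_k = b` (in particular continuous on `[a,b]`). -/
def IsPiecewiseC1 (σ : ℝ → X) (a b : ℝ) : Prop :=
  ContinuousOn σ (Set.Icc a b) ∧
  ∃ (k : ℕ) (t : ℕ → ℝ), Monotone t ∧ t 0 = a ∧ t k = b ∧
    ∀ i < k, ContMDiffOn 𝓘(ℝ, ℝ) 𝓘(ℝ, E) 1 σ (Set.Icc (t i) (t (i + 1)))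

variable [IsManifold 𝓘(ℝ, E) ∞ X]

namespace FinslerStructure

variable (F : FinslerStructure E X)

/-- The Finsler length `∫_a^b F(σ(t), σ'(t)) dt`. The velocity exists off the finitely many
break points. -/
def length (σ : ℝ → X) (a b : ℝ) : ℝ :=
  ∫ t in a..b, F.toFun (σ t) (mfderiv 𝓘(ℝ, ℝ) 𝓘(ℝ, E) σ t (1 : ℝ))

/-- The Finsler distance of a connected Finsler manifold. -/
def dist (x y : X) : ℝ :=
  sInf {l : ℝ | ∃ (a b : ℝ) (σ : ℝ → X), a ≤ b ∧ IsPiecewiseC1 E σ a b ∧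
    σ a = x ∧ σ b = y ∧ l = F.length σ a b}

/-- The cone `SC_b^1(X)_+` of nonnegative bounded semi-Lipschitz `C¹` functions. -/
def coneSC : Set (X → ℝ) :=
  {f | ContMDiff 𝓘(ℝ, E) 𝓘(ℝ, ℝ) 1 f ∧ BddAbove (Set.range fun x => |f x|) ∧
    IsSemiLipschitz F.dist f ∧ ∀ x, 0 ≤ f x}

/-- The space `𝒜(X)`, the linear span of `SC_b^1(X)_+` in `ℝ^X`. -/
def algA : Submodule ℝ (X → ℝ) := Submodule.span ℝ F.coneSC

open Classical in
/-- The extended asymmetric hemi-norm of `𝒜(X)`: `max {‖f‖_∞, ‖f|_S}` on `SC_b^1(X)_+`,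
and `+∞` elsewhere. -/
def hemiNorm (f : F.algA) : ℝ≥0∞ :=
  if (f : X → ℝ) ∈ F.coneSC then
    ENNReal.ofReal (max (supNorm (f : X → ℝ)) (semiLipConst F.dist (f : X → ℝ)))
  else ⊤

/-- The dual cone `𝒜(X)^*`: linear functionals that are upper semicontinuous for the forward
topology of the extended quasi-hemi-metric `(f, g) ↦ ‖g - f|`. -/
def dualCone : Set (F.algA →ₗ[ℝ] ℝ) :=
  {φ | @UpperSemicontinuous F.algA ℝ
    (forwardTopology fun f g : F.algA => F.hemiNorm (g - f)) _ φ}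

/-- The dual norm `‖φ|^* = sup {φ(f) : ‖f| ≤ 1}`. -/
def dualNorm (φ : F.algA →ₗ[ℝ] ℝ) : EReal :=
  ⨆ f : {f : F.algA // F.hemiNorm f ≤ 1}, ((φ f : ℝ) : EReal)

/-- The evaluation functional `δ_x`. -/
def eval (x : X) : F.algA →ₗ[ℝ] ℝ := LinearMap.proj x ∘ₗ F.algA.subtype

end FinslerStructure

end Manifold

end Finsler

end

/-! Upper bound and membership in the dual cone: a function `f` with `‖f| ≤ r` lies in the cone and
satisfies `f y - f x ≤ r * d(x,y)`. Taking `r = 1` bounds the dual norm, and small `r` gives upper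
semicontinuity.

Lower bound: the ideal test function is `min (d(x,·)) 1`, which fails only to be `C¹`.
`exists_contMDiff_approx` replaces it by a smooth `f` that is uniformly `η`-close with `df ≤ (1 +
2η) F`. Integrating along paths makes `f` semi-Lipschitz with constant `1 + 2η`, so `(f + η) / (1 +
2η)` lies in the unit ball, and `η` tends to `0`.

The approximation is local. In a chart, prolonging paths by segments bounds increments of `d(x,·)`
by `c` times the norm frozen at a nearby point, for any `c > 1`; convolution averages translates and
so keeps this bound (`exists_contDiff_approx`). A partition of unity `ψ i` glues the local pieces `u
i` (`dirDeriv_finsum_smul_le`): as `∑ dψ i = 0`, gluing costs only `∑ (u i - g₀) dψ i`, small once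
each local error is small against the bound on `dψ i`. -/

open Set MeasureTheory Metric Filter

noncomputable section

namespace Finsler

/-! ### Lengths of paths, and semi-Lipschitz bounds from bounds on the differential. -/

namespace FinslerStructure

variable {E : Type*} [NormedAddCommGroup E] [NormedSpace ℝ E]
  {X : Type*} [TopologicalSpace X] [ChartedSpace E X]

/-- The derivative of a real function `f` at `p` in the direction of the tangent vector `v`. -/
def dirDeriv (f : X → ℝ) (p : X) (v : TangentSpace 𝓘(ℝ, E) p) : ℝ :=
  mfderiv 𝓘(ℝ, E) 𝓘(ℝ, ℝ) f p v

variable [IsManifold 𝓘(ℝ, E) ∞ X] (F : FinslerStructure E X)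

/-- The speed `t ↦ F(σ(t), σ'(t))` of a curve. -/
def speed (σ : ℝ → X) (t : ℝ) : ℝ :=
  F.toFun (σ t) (mfderiv 𝓘(ℝ, ℝ) 𝓘(ℝ, E) σ t (1 : ℝ))

theorem length_eq_integral_speed (σ : ℝ → X) (a b : ℝ) :
    F.length σ a b = ∫ t in a..b, F.speed σ t := rfl

theorem toFun_nonneg (x : X) (v : TangentSpace 𝓘(ℝ, E) x) : 0 ≤ F.toFun x v :=
  (F.minkowski x).nonneg v

theorem toFun_smul (x : X) {c : ℝ} (hc : 0 ≤ c) (v : TangentSpace 𝓘(ℝ, E) x) :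
    F.toFun x (c • v) = c * F.toFun x v :=
  (F.minkowski x).pos_homogeneous c v hc

theorem speed_nonneg (σ : ℝ → X) (t : ℝ) : 0 ≤ F.speed σ t :=
  F.toFun_nonneg _ _

theorem length_nonneg (σ : ℝ → X) {a b : ℝ} (hab : a ≤ b) : 0 ≤ F.length σ a b :=
  intervalIntegral.integral_nonneg hab fun t _ => F.speed_nonneg σ t

/-- The set of lengths of the piecewise `C¹` paths from `x` to `y`. -/
def pathLengths (x y : X) : Set ℝ :=
  {l : ℝ | ∃ (a b : ℝ) (σ : ℝ → X), a ≤ b ∧ IsPiecewiseC1 E σ a b ∧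
    σ a = x ∧ σ b = y ∧ l = F.length σ a b}

theorem dist_eq_sInf (x y : X) : F.dist x y = sInf (F.pathLengths x y) := rfl

theorem nonneg_of_mem_pathLengths {x y : X} {l : ℝ} (hl : l ∈ F.pathLengths x y) : 0 ≤ l := by
  obtain ⟨a, b, σ, hab, -, -, -, rfl⟩ := hl
  exact F.length_nonneg σ hab

theorem dist_nonneg (x y : X) : 0 ≤ F.dist x y :=
  Real.sInf_nonneg fun _ hl => F.nonneg_of_mem_pathLengths hl

theorem dist_le_of_mem {x y : X} {l : ℝ} (hl : l ∈ F.pathLengths x y) : F.dist x y ≤ l :=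
  csInf_le ⟨0, fun _ h => F.nonneg_of_mem_pathLengths h⟩ hl

theorem continuousOn_toFun_mfderivWithin {E' : Type*} [NormedAddCommGroup E'] [NormedSpace ℝ E']
    {s : Set E'} {σ : E' → X} (hσ : ContMDiffOn 𝓘(ℝ, E') 𝓘(ℝ, E) 1 σ s)
    (hs : UniqueDiffOn ℝ s) :
    ContinuousOn (fun q : E' × E' =>
      F.toFun (σ q.1) (mfderivWithin 𝓘(ℝ, E') 𝓘(ℝ, E) σ s q.1 q.2)) (s ×ˢ univ) := by
  have h1 := hσ.continuousOn_tangentMapWithin le_rfl hs.uniqueMDiffOn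
  have h2 : Continuous (fun q : E' × E' => (⟨q.1, q.2⟩ : TangentBundle 𝓘(ℝ, E') E')) :=
    (tangentBundleModelSpaceHomeomorph 𝓘(ℝ, E')).symm.continuous
  exact F.continuous.comp_continuousOn (h1.comp h2.continuousOn fun q hq => hq.1)

/-- The one-sided derivative gives a speed continuous up to the endpoints, and it agrees with the
two-sided one in the interior. -/
theorem intervalIntegrable_speed {σ : ℝ → X} {a b : ℝ} (hab : a ≤ b)
    (hσ : ContMDiffOn 𝓘(ℝ, ℝ) 𝓘(ℝ, E) 1 σ (Icc a b)) :
    IntervalIntegrable (F.speed σ) volume a b := by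
  obtain rfl | hlt := hab.eq_or_lt
  · simp
  have h := F.continuousOn_toFun_mfderivWithin hσ (uniqueDiffOn_Icc hlt)
  have h' : ContinuousOn (fun t : ℝ =>
      F.toFun (σ t) (mfderivWithin 𝓘(ℝ, ℝ) 𝓘(ℝ, E) σ (Icc a b) t (1 : ℝ))) (Icc a b) :=
    h.comp (f := fun t : ℝ => (t, (1 : ℝ))) (by fun_prop) fun t ht => ⟨ht, mem_univ _⟩
  refine (h'.intervalIntegrable_of_Icc hab).congr_uIoo ?_
  intro t ht
  rw [uIoo_of_le hab] at ht
  simp only [speed]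
  rw [mfderivWithin_of_mem_nhds (Icc_mem_nhds ht.1 ht.2)]

theorem intervalIntegrable_speed_of_isPiecewiseC1 {σ : ℝ → X} {a b : ℝ}
    (hσ : IsPiecewiseC1 E σ a b) : IntervalIntegrable (F.speed σ) volume a b := by
  obtain ⟨-, k, t, ht, rfl, rfl, h⟩ := hσ
  exact IntervalIntegrable.trans_iterate fun i hi =>
    F.intervalIntegrable_speed (ht i.le_succ) (h i hi)

/-- At the endpoints `mfderiv` sees values outside `[a, b]`, but two points do not affect the
integral. -/
theorem length_congr {σ τ : ℝ → X} {a b : ℝ} (hab : a ≤ b) (h : EqOn σ τ (Icc a b)) :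
    F.length σ a b = F.length τ a b := by
  refine intervalIntegral.integral_congr_Ioo_of_le hab fun t ht => ?_
  have hE : σ =ᶠ[𝓝 t] τ := Filter.eventuallyEq_of_mem (Icc_mem_nhds ht.1 ht.2) h
  have := hE.mfderiv_eq (I := 𝓘(ℝ, ℝ)) (I' := 𝓘(ℝ, E))
  have h0 := hE.eq_of_nhds
  have key : ∀ (p q : X) (v w : E), p = q → v = w → F.toFun p v = F.toFun q w := by
    rintro p _ v _ rfl rfl
    rfl
  exact key _ _ _ _ h0 (congrArg (fun L : ℝ →L[ℝ] E => L 1) this)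

/-- Prolongation of a piecewise `C¹` path by a `C¹` path. -/
theorem add_length_mem_pathLengths {x : X} {σ τ : ℝ → X} {a b c : ℝ} (hab : a ≤ b) (hbc : b ≤ c)
    (hσ : IsPiecewiseC1 E σ a b) (hx : σ a = x)
    (hτ : ContMDiffOn 𝓘(ℝ, ℝ) 𝓘(ℝ, E) 1 τ (Icc b c)) (hb : σ b = τ b) :
    F.length σ a b + F.length τ b c ∈ F.pathLengths x (τ c) := by
  classical
  set ρ : ℝ → X := fun t => if t ≤ b then σ t else τ t with hρ
  have h1 : EqOn ρ σ (Icc a b) := fun t ht => by simp [hρ, ht.2]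
  have h2 : EqOn ρ τ (Icc b c) := fun t ht => by
    rcases ht.1.eq_or_lt with h | h
    · subst h; simpa [hρ] using hb
    · simp [hρ, not_le.2 h]
  have hpw : IsPiecewiseC1 E ρ a c := by
    obtain ⟨hc, k, t, ht, h0, hk, h⟩ := hσ
    -- The old nodes may grow arbitrarily past index `k`, so all later ones are reset to `c`.
    refine ⟨?_, k + 1, fun i => if i ≤ k then t i else c, ?_, by simpa using h0, by simp, ?_⟩
    · rw [← Icc_union_Icc_eq_Icc hab hbc]
      exact (hc.congr h1).union_of_isClosed (hτ.continuousOn.congr h2) isClosed_Icc isClosed_Icc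
    · refine monotone_nat_of_le_succ fun i => ?_
      rcases lt_trichotomy i k with hi | hi | hi
      · simpa [hi.le, Nat.succ_le_of_lt hi] using ht i.le_succ
      · subst hi; simpa [hk] using hbc
      · simp [not_le.2 hi, not_le.2 (hi.trans i.lt_succ_self)]
    · intro i hi
      rcases (Nat.lt_succ_iff.1 hi).eq_or_lt with rfl | hi
      · simpa [hk] using hτ.congr h2
      · have hsub : Icc (t i) (t (i + 1)) ⊆ Icc a b :=
          Icc_subset_Icc (h0 ▸ ht i.zero_le) (hk ▸ ht hi)
        simpa [hi.le, Nat.succ_le_of_lt hi] using (h i hi).congr (h1.mono hsub)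
  refine ⟨a, c, ρ, hab.trans hbc, hpw, ?_, ?_, ?_⟩
  · rw [h1 ⟨le_rfl, hab⟩, hx]
  · exact h2 ⟨hbc, le_rfl⟩
  · rw [← F.length_congr hab h1, ← F.length_congr hbc h2]
    refine intervalIntegral.integral_add_adjacent_intervals (f := F.speed ρ) ?_ ?_
    · refine (F.intervalIntegrable_speed_of_isPiecewiseC1 hpw).mono_set ?_
      rw [uIcc_of_le hab, uIcc_of_le (hab.trans hbc)]
      exact Icc_subset_Icc_right hbc
    · refine (F.intervalIntegrable_speed_of_isPiecewiseC1 hpw).mono_set ?_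
      rw [uIcc_of_le hbc, uIcc_of_le (hab.trans hbc)]
      exact Icc_subset_Icc_left hab

/-- The inequality form of the fundamental theorem of calculus needs only an integrable majorant of
`(f ∘ σ)'`, here `c` times the speed. -/
theorem sub_le_mul_length {f : X → ℝ} {c : ℝ} (hf : MDifferentiable 𝓘(ℝ, E) 𝓘(ℝ, ℝ) f)
    (hfc : ∀ p v, dirDeriv f p v ≤ c * F.toFun p v)
    {σ : ℝ → X} {a b : ℝ} (hab : a ≤ b) (hσ : ContMDiffOn 𝓘(ℝ, ℝ) 𝓘(ℝ, E) 1 σ (Icc a b)) :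
    f (σ b) - f (σ a) ≤ c * F.length σ a b := by
  rw [length_eq_integral_speed, ← intervalIntegral.integral_const_mul]
  refine intervalIntegral.sub_le_integral_of_hasDeriv_right_of_le (g := f ∘ σ)
    (g' := fun t => dirDeriv f (σ t) (mfderiv 𝓘(ℝ, ℝ) 𝓘(ℝ, E) σ t (1 : ℝ)))
    hab (hf.continuous.comp_continuousOn hσ.continuousOn) ?_ ?_ fun t _ => hfc _ _
  · intro t ht
    have h1 : MDifferentiableAt 𝓘(ℝ, ℝ) 𝓘(ℝ, E) σ t :=
      (hσ.contMDiffAt (Icc_mem_nhds ht.1 ht.2)).mdifferentiableAt one_ne_zero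
    have h2 : HasFDerivAt (f ∘ σ) (_ : ℝ →L[ℝ] ℝ) t :=
      ((hf (σ t)).hasMFDerivAt.comp t h1.hasMFDerivAt).hasFDerivAt
    exact h2.hasDerivAt.hasDerivWithinAt
  · exact (intervalIntegrable_iff_integrableOn_Icc_of_le hab).1
      ((F.intervalIntegrable_speed hab hσ).const_mul c)

theorem sub_le_mul_of_mem_pathLengths {f : X → ℝ} {c : ℝ}
    (hf : MDifferentiable 𝓘(ℝ, E) 𝓘(ℝ, ℝ) f)
    (hfc : ∀ p v, dirDeriv f p v ≤ c * F.toFun p v) {x y : X} {l : ℝ}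
    (hl : l ∈ F.pathLengths x y) : f y - f x ≤ c * l := by
  obtain ⟨a, b, σ, hab, ⟨-, k, t, ht, rfl, rfl, h⟩, rfl, rfl, rfl⟩ := hl
  rw [length_eq_integral_speed, ← intervalIntegral.sum_integral_adjacent_intervals fun i hi =>
    F.intervalIntegrable_speed (ht i.le_succ) (h i hi), Finset.mul_sum,
    ← Finset.sum_range_sub (fun i => f (σ (t i)))]
  exact Finset.sum_le_sum fun i hi =>
    F.sub_le_mul_length hf hfc (ht i.le_succ) (h i (Finset.mem_range.1 hi))

/-- A function whose differential is dominated by `c F` is semi-Lipschitz with constant `c`. -/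
theorem semiLipschitzWith_of_mfderiv_le {f : X → ℝ} {c : ℝ} (hc : 0 ≤ c)
    (hf : MDifferentiable 𝓘(ℝ, E) 𝓘(ℝ, ℝ) f)
    (hfc : ∀ p v, dirDeriv f p v ≤ c * F.toFun p v)
    (hne : ∀ x y, (F.pathLengths x y).Nonempty) : SemiLipschitzWith F.dist c f := by
  intro x y
  refine max_le ?_ (mul_nonneg hc (F.dist_nonneg x y))
  rw [dist_eq_sInf, ← smul_eq_mul, ← Real.sInf_smul_of_nonneg hc]
  refine le_csInf ((hne x y).smul_set) ?_
  rintro _ ⟨l, hl, rfl⟩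
  exact F.sub_le_mul_of_mem_pathLengths hf hfc hl

end FinslerStructure

/-! ### Positivity of Minkowski norms and compactness estimates for families of norms. -/

section Minkowski

variable {E : Type*} [NormedAddCommGroup E] [NormedSpace ℝ E]

theorem fderiv_fderiv_apply_eq_zero_of_ray {g : E → ℝ} {v : E} (hv : v ≠ 0)
    (hg : ContDiffOn ℝ ∞ g {u : E | u ≠ 0}) (h0 : ∀ t : ℝ, 0 < t → g (t • v) = 0) :
    fderiv ℝ (fderiv ℝ g) v v v = 0 := by
  have hat : ∀ t : ℝ, 0 < t → ContDiffAt ℝ ∞ g (t • v) := fun t ht =>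
    hg.contDiffAt (isOpen_ne.mem_nhds (smul_ne_zero ht.ne' hv))
  have hline : ∀ t : ℝ, HasDerivAt (fun s : ℝ => s • v) v t := fun t => by
    simpa using (hasDerivAt_id t).smul_const v
  have h1 : ∀ t : ℝ, 0 < t → fderiv ℝ g (t • v) v = 0 := by
    intro t ht
    have hd : DifferentiableAt ℝ g (t • v) := (hat t ht).differentiableAt (by simp)
    have hc := hd.hasFDerivAt.comp_hasDerivAt t (hline t)
    refine hc.unique ((hasDerivAt_const t (0 : ℝ)).congr_of_eventuallyEq ?_)
    filter_upwards [lt_mem_nhds ht] with s hs using h0 s hs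
  have hd2 : DifferentiableAt ℝ (fderiv ℝ g) ((1 : ℝ) • v) :=
    ((hat 1 one_pos).fderiv_right (m := 1) (by norm_cast)).differentiableAt one_ne_zero
  have hc := (ContinuousLinearMap.apply ℝ ℝ v).hasFDerivAt.comp_hasDerivAt (1 : ℝ)
    (hd2.hasFDerivAt.comp_hasDerivAt 1 (hline 1))
  have h2 := hc.unique ((hasDerivAt_const (1 : ℝ) (0 : ℝ)).congr_of_eventuallyEq (by
    filter_upwards [lt_mem_nhds one_pos] with s hs using h1 s hs))
  rw [one_smul] at h2
  exact h2

/-- If `N v = 0`, homogeneity kills `N ^ 2` on the whole ray through `v`, so its Hessian at `v`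
vanishes on `(v, v)`, against definiteness. -/
theorem IsMinkowskiNorm.pos {N : E → ℝ} (hN : IsMinkowskiNorm N) {v : E} (hv : v ≠ 0) :
    0 < N v := by
  refine (hN.nonneg v).lt_of_ne' fun h0 => ?_
  have h3 := hN.posDef v hv v hv
  rw [fderiv_fderiv_apply_eq_zero_of_ray hv (hN.smooth.pow 2) fun t ht => by
    rw [hN.pos_homogeneous t v ht.le, h0]; simp] at h3
  simp at h3

/-- Continuous families, over a compact set, of positive functions that are positively
homogeneous of degree one. -/
structure IsNormFamilyOn (N : E → E → ℝ) (K : Set E) : Prop where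
  isCompact : IsCompact K
  continuousOn : ContinuousOn (fun q : E × E => N q.1 q.2) (K ×ˢ univ)
  smul : ∀ z ∈ K, ∀ c : ℝ, 0 ≤ c → ∀ v, N z (c • v) = c * N z v
  pos : ∀ z ∈ K, ∀ v, v ≠ 0 → 0 < N z v

namespace IsNormFamilyOn

variable {N : E → E → ℝ} {K : Set E}

theorem map_zero (hN : IsNormFamilyOn N K) {z : E} (hz : z ∈ K) : N z 0 = 0 := by
  simpa using hN.smul z hz 0 le_rfl 0

theorem nonneg (hN : IsNormFamilyOn N K) {z : E} (hz : z ∈ K) (v : E) : 0 ≤ N z v := by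
  rcases eq_or_ne v 0 with rfl | hv
  · exact (hN.map_zero hz).ge
  · exact (hN.pos z hz v hv).le

theorem eq_norm_mul (hN : IsNormFamilyOn N K) {z : E} (hz : z ∈ K) (v : E) :
    N z v = ‖v‖ * N z (‖v‖⁻¹ • v) := by
  rcases eq_or_ne v 0 with rfl | hv
  · simp [hN.map_zero hz]
  · rw [← hN.smul z hz _ (norm_nonneg v), smul_inv_smul₀ (norm_ne_zero_iff.2 hv)]

theorem inv_norm_smul_mem_sphere {v : E} (hv : v ≠ 0) : ‖v‖⁻¹ • v ∈ sphere (0 : E) 1 := by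
  simp [norm_smul, norm_ne_zero_iff.2 hv]

variable [FiniteDimensional ℝ E]

theorem exists_mul_norm_le (hN : IsNormFamilyOn N K) :
    ∃ m > 0, ∀ z ∈ K, ∀ v, m * ‖v‖ ≤ N z v := by
  have hcomp : IsCompact (K ×ˢ sphere (0 : E) 1) := hN.isCompact.prod (isCompact_sphere 0 1)
  obtain ⟨m, hm, h⟩ := hcomp.exists_forall_le' (a := (0 : ℝ))
    (hN.continuousOn.mono (prod_mono_right (subset_univ _))) fun q hq =>
      hN.pos q.1 hq.1 q.2 (ne_zero_of_mem_unit_sphere ⟨q.2, hq.2⟩)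
  refine ⟨m, hm, fun z hz v => ?_⟩
  rcases eq_or_ne v 0 with rfl | hv
  · simp [hN.map_zero hz]
  · rw [hN.eq_norm_mul hz v, mul_comm]
    exact mul_le_mul_of_nonneg_left (h (z, ‖v‖⁻¹ • v) ⟨hz, inv_norm_smul_mem_sphere hv⟩)
      (norm_nonneg v)

theorem exists_le_mul_norm (hN : IsNormFamilyOn N K) :
    ∃ M, 0 ≤ M ∧ ∀ z ∈ K, ∀ v, N z v ≤ M * ‖v‖ := by
  have hcomp : IsCompact (K ×ˢ sphere (0 : E) 1) := hN.isCompact.prod (isCompact_sphere 0 1)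
  obtain ⟨M, hM⟩ := hcomp.bddAbove_image
    (hN.continuousOn.mono (prod_mono_right (subset_univ _)))
  refine ⟨max M 0, le_max_right _ _, fun z hz v => ?_⟩
  rcases eq_or_ne v 0 with rfl | hv
  · simp [hN.map_zero hz]
  · rw [hN.eq_norm_mul hz v, mul_comm]
    exact mul_le_mul_of_nonneg_right ((hM ⟨(z, ‖v‖⁻¹ • v),
      ⟨hz, inv_norm_smul_mem_sphere hv⟩, rfl⟩).trans (le_max_left _ _)) (norm_nonneg v)

/-- Uniform continuity on `K` times the unit sphere gives an additive error `(c - 1) * m`; the lower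
bound `m` makes it a factor `c`. -/
theorem exists_forall_le_mul (hN : IsNormFamilyOn N K) {c : ℝ} (hc : 1 < c) :
    ∃ δ > 0, ∀ z ∈ K, ∀ z' ∈ K, dist z' z < δ → ∀ v, N z' v ≤ c * N z v := by
  have hcomp : IsCompact (K ×ˢ sphere (0 : E) 1) := hN.isCompact.prod (isCompact_sphere 0 1)
  obtain ⟨m, hm, hml⟩ := hN.exists_mul_norm_le
  have hu := hcomp.uniformContinuousOn_of_continuous
    (hN.continuousOn.mono (prod_mono_right (subset_univ _)))
  obtain ⟨δ, hδ, h⟩ := Metric.uniformContinuousOn_iff.1 hu ((c - 1) * m)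
    (mul_pos (sub_pos.2 hc) hm)
  refine ⟨δ, hδ, fun z hz z' hz' hd v => ?_⟩
  rcases eq_or_ne v 0 with rfl | hv
  · simp [hN.map_zero hz, hN.map_zero hz']
  · rw [hN.eq_norm_mul hz v, hN.eq_norm_mul hz' v, mul_left_comm]
    refine mul_le_mul_of_nonneg_left ?_ (norm_nonneg v)
    have hs := inv_norm_smul_mem_sphere hv
    have h1 := h (z', ‖v‖⁻¹ • v) ⟨hz', hs⟩ (z, ‖v‖⁻¹ • v) ⟨hz, hs⟩ (by simpa [Prod.dist_eq])
    rw [Real.dist_eq] at h1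
    have h2 := hml z hz (‖v‖⁻¹ • v)
    rw [mem_sphere_zero_iff_norm.1 hs, mul_one] at h2
    nlinarith [(abs_lt.1 h1).2, mul_le_mul_of_nonneg_left h2 (sub_pos.2 hc).le]

end IsNormFamilyOn

end Minkowski

/-! ### The Finsler structure and the distance in a chart. -/

namespace FinslerStructure

variable {E : Type*} [NormedAddCommGroup E] [NormedSpace ℝ E]
  {X : Type*} [TopologicalSpace X] [ChartedSpace E X] [IsManifold 𝓘(ℝ, E) ∞ X]
  (F : FinslerStructure E X)

/-- The Finsler structure read in the chart at `p`. -/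
def chartNorm (p : X) (z v : E) : ℝ :=
  F.toFun ((chartAt E p).symm z) (mfderiv 𝓘(ℝ, E) 𝓘(ℝ, E) (chartAt E p).symm z v)

theorem chartNorm_nonneg (p : X) (z v : E) : 0 ≤ F.chartNorm p z v := F.toFun_nonneg _ _

theorem chartNorm_smul (p : X) (z : E) {c : ℝ} (hc : 0 ≤ c) (v : E) :
    F.chartNorm p z (c • v) = c * F.chartNorm p z v := by
  refine (congrArg (F.toFun _) ?_).trans
    (F.toFun_smul _ hc (mfderiv 𝓘(ℝ, E) 𝓘(ℝ, E) (chartAt E p).symm z v))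
  exact ContinuousLinearMap.map_smul _ c v

theorem contMDiffOn_chartAt_symm_one (p : X) :
    ContMDiffOn 𝓘(ℝ, E) 𝓘(ℝ, E) 1 (chartAt E p).symm (chartAt E p).target :=
  (contMDiffOn_chart_symm (n := ∞)).of_le (by norm_cast)

theorem continuousOn_chartNorm (p : X) :
    ContinuousOn (fun q : E × E => F.chartNorm p q.1 q.2) ((chartAt E p).target ×ˢ univ) := by
  refine (F.continuousOn_toFun_mfderivWithin (contMDiffOn_chartAt_symm_one p)
    (chartAt E p).open_target.uniqueDiffOn).congr fun q hq => ?_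
  simp only [chartNorm]
  rw [mfderivWithin_of_isOpen (chartAt E p).open_target hq.1]

theorem mdifferentiable_chartAt (p : X) :
    (chartAt E p).MDifferentiable 𝓘(ℝ, E) 𝓘(ℝ, E) :=
  haveI : IsManifold 𝓘(ℝ, E) 1 X := .of_le (n := ∞) (by norm_cast)
  mdifferentiable_chart p

theorem chartNorm_pos (p : X) {z : E} (hz : z ∈ (chartAt E p).target) {v : E} (hv : v ≠ 0) :
    0 < F.chartNorm p z v := by
  refine (F.minkowski _).pos fun h => hv ?_
  refine (mdifferentiable_chartAt p).symm.mfderiv_injective hz ?_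
  exact h.trans (ContinuousLinearMap.map_zero _).symm

theorem isNormFamilyOn_chartNorm (p : X) {K : Set E} (hK : IsCompact K)
    (hKt : K ⊆ (chartAt E p).target) : IsNormFamilyOn (F.chartNorm p) K where
  isCompact := hK
  continuousOn := (F.continuousOn_chartNorm p).mono (prod_mono_left hKt)
  smul z _ _ hc v := F.chartNorm_smul p z hc v
  pos _ hz _ hv := F.chartNorm_pos p (hKt hz) hv

theorem chartNorm_mfderiv (p : X) {q : X} (hq : q ∈ (chartAt E p).source)
    (v : TangentSpace 𝓘(ℝ, E) q) :
    F.chartNorm p (chartAt E p q) (mfderiv 𝓘(ℝ, E) 𝓘(ℝ, E) (chartAt E p) q v) = F.toFun q v := by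
  have h := congrArg (fun L : E →L[ℝ] E => L v)
    ((mdifferentiable_chartAt p).symm_comp_deriv hq)
  have key : ∀ (a b : X) (v w : E), a = b → v = w → F.toFun a v = F.toFun b w := by
    rintro p _ v _ rfl rfl
    rfl
  exact key _ _ _ _ ((chartAt E p).left_inv hq) h

theorem dirDeriv_comp_chartAt (p : X) {q : X} (hq : q ∈ (chartAt E p).source) {k : E → ℝ}
    (hk : DifferentiableAt ℝ k (chartAt E p q)) (v : TangentSpace 𝓘(ℝ, E) q) :
    dirDeriv (k ∘ chartAt E p) q v =
      fderiv ℝ k (chartAt E p q) (mfderiv 𝓘(ℝ, E) 𝓘(ℝ, E) (chartAt E p) q v) := by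
  have h := mfderiv_comp q hk.mdifferentiableAt
    ((mdifferentiable_chartAt p).mdifferentiableAt hq)
  rw [mfderiv_eq_fderiv] at h
  exact congrArg (fun L : E →L[ℝ] ℝ => L v) h

/-- Prolongation of a path by a segment in a chart. -/
theorem exists_mem_pathLengths_le_add (p : X) {z w : E} {m : ℝ}
    (hseg : ∀ t ∈ Icc (0 : ℝ) 1, z + t • (w - z) ∈ (chartAt E p).target)
    (hm : ∀ t ∈ Icc (0 : ℝ) 1, F.chartNorm p (z + t • (w - z)) (w - z) ≤ m) {x : X} {l : ℝ}
    (hl : l ∈ F.pathLengths x ((chartAt E p).symm z)) :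
    ∃ l' ∈ F.pathLengths x ((chartAt E p).symm w), l' ≤ l + m := by
  obtain ⟨a, b, σ, hab, hσ, hx, hb, rfl⟩ := hl
  set γ : ℝ → E := fun t => z + (t - b) • (w - z) with hγ
  set τ : ℝ → X := (chartAt E p).symm ∘ γ with hτ
  have hIcc : ∀ t ∈ Icc b (b + 1), t - b ∈ Icc (0 : ℝ) 1 := fun t ht =>
    ⟨by linarith [ht.1], by linarith [ht.2]⟩
  have hγd : ∀ t, HasDerivAt γ (w - z) t := fun t => by
    simpa [hγ] using (((hasDerivAt_id t).sub_const b).smul_const (w - z)).const_add z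
  have hγs : ContDiff ℝ 1 γ := by fun_prop
  have hC1 : ContMDiffOn 𝓘(ℝ, ℝ) 𝓘(ℝ, E) 1 τ (Icc b (b + 1)) :=
    (contMDiffOn_chartAt_symm_one p).comp hγs.contMDiff.contMDiffOn fun t ht =>
      hseg _ (hIcc t ht)
  have hbb : b ≤ b + 1 := by linarith
  have hle : F.length τ b (b + 1) ≤ m := by
    have h := intervalIntegral.integral_mono_on hbb (F.intervalIntegrable_speed hbb hC1)
      (intervalIntegrable_const (c := m)) (g := fun _ => m) fun t ht => by
        have h1 := mfderiv_comp t
          ((mdifferentiable_chartAt p).mdifferentiableAt_symm (hseg _ (hIcc t ht)))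
          (hγd t).differentiableAt.mdifferentiableAt
        have h2 : F.speed τ t = F.chartNorm p (z + (t - b) • (w - z)) (w - z) := by
          refine congrArg (F.toFun (τ t)) ?_
          refine (congrArg (fun L : ℝ →L[ℝ] E => L 1) h1).trans ?_
          have h3 : mfderiv 𝓘(ℝ, ℝ) 𝓘(ℝ, E) γ t (1 : ℝ) = w - z := by
            rw [mfderiv_eq_fderiv]
            exact (hγd t).deriv
          exact congrArg (mfderiv 𝓘(ℝ, E) 𝓘(ℝ, E) (chartAt E p).symm (γ t)) h3
        rw [h2]
        exact hm _ (hIcc t ht)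
    simpa [length_eq_integral_speed] using h
  have h := F.add_length_mem_pathLengths hab hbb hσ hx hC1 (by simp [hτ, hγ, hb])
  refine ⟨_, ?_, add_le_add_right hle _⟩
  simpa [hτ, hγ] using h

theorem zero_mem_pathLengths (x : X) : (0 : ℝ) ∈ F.pathLengths x x :=
  ⟨0, 0, fun _ => x, le_rfl, ⟨continuousOn_const, 0, fun _ => 0, monotone_const, rfl, rfl,
    by simp⟩, rfl, rfl, by simp [length]⟩

theorem dist_self (x : X) : F.dist x x = 0 :=
  (F.dist_le_of_mem (F.zero_mem_pathLengths x)).antisymm (F.dist_nonneg x x)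

theorem add_smul_sub_mem_closedBall {z₀ z w : E} {r : ℝ} (hz : z ∈ closedBall z₀ r)
    (hw : w ∈ closedBall z₀ r) {t : ℝ} (ht : t ∈ Icc (0 : ℝ) 1) :
    z + t • (w - z) ∈ closedBall z₀ r :=
  (convex_closedBall z₀ r).add_smul_sub_mem hz hw ht

/-- A piecewise `C¹` path joins any two points of a connected manifold. -/
theorem pathLengths_nonempty [ConnectedSpace X] (x y : X) : (F.pathLengths x y).Nonempty := by
  -- Segments in a chart ball make reachability from `x` locally constant, so the reachable set is
  -- clopen.
  have key : ∀ q : X, ∃ V ∈ 𝓝 q, ∀ y ∈ V, ∀ y' ∈ V, (F.pathLengths x y).Nonempty →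
      (F.pathLengths x y').Nonempty := by
    intro q
    set e := chartAt E q
    obtain ⟨r, hr, hrt⟩ := nhds_basis_closedBall.mem_iff.1
      (e.open_target.mem_nhds (mem_chart_target E q))
    refine ⟨e.source ∩ e ⁻¹' closedBall (e q) r, Filter.inter_mem
      (chart_source_mem_nhds E q) ((e.continuousAt (mem_chart_source E q)).preimage_mem_nhds
        (closedBall_mem_nhds _ hr)), ?_⟩
    rintro y ⟨hy, hyr⟩ y' ⟨hy', hyr'⟩ ⟨l, hl⟩
    have hseg : ∀ t ∈ Icc (0 : ℝ) 1, e y + t • (e y' - e y) ∈ e.target := fun t ht =>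
      hrt (add_smul_sub_mem_closedBall hyr hyr' ht)
    have hcont : ContinuousOn (fun t : ℝ => F.chartNorm q (e y + t • (e y' - e y)) (e y' - e y))
        (Icc 0 1) :=
      (F.continuousOn_chartNorm q).comp
        (f := fun t : ℝ => (e y + t • (e y' - e y), e y' - e y)) (by fun_prop)
        fun t ht => ⟨hseg t ht, mem_univ _⟩
    obtain ⟨m, hm⟩ := isCompact_Icc.bddAbove_image hcont
    rw [← e.left_inv hy] at hl
    obtain ⟨l', hl', -⟩ := F.exists_mem_pathLengths_le_add q hseg
      (fun t ht => hm ⟨t, ht, rfl⟩) hl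
    rw [e.left_inv hy'] at hl'
    exact ⟨l', hl'⟩
  have hclopen : IsClopen {y | (F.pathLengths x y).Nonempty} := by
    constructor
    · refine ⟨isOpen_iff_mem_nhds.2 fun q hq => ?_⟩
      obtain ⟨V, hV, h⟩ := key q
      exact Filter.mem_of_superset hV fun y hy hy' => hq (h y hy q (mem_of_mem_nhds hV) hy')
    · refine isOpen_iff_mem_nhds.2 fun q hq => ?_
      obtain ⟨V, hV, h⟩ := key q
      exact Filter.mem_of_superset hV fun y hy => h q (mem_of_mem_nhds hV) y hy hq
  exact eq_univ_iff_forall.1 (hclopen.eq_univ ⟨x, 0, F.zero_mem_pathLengths x⟩) y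

theorem dist_le_dist_add [ConnectedSpace X] (p x : X) {z w : E} {m : ℝ}
    (hseg : ∀ t ∈ Icc (0 : ℝ) 1, z + t • (w - z) ∈ (chartAt E p).target)
    (hm : ∀ t ∈ Icc (0 : ℝ) 1, F.chartNorm p (z + t • (w - z)) (w - z) ≤ m) :
    F.dist x ((chartAt E p).symm w) ≤ F.dist x ((chartAt E p).symm z) + m := by
  rw [← sub_le_iff_le_add]
  refine le_csInf (F.pathLengths_nonempty x _) fun l hl => ?_
  obtain ⟨l', hl', hle⟩ := F.exists_mem_pathLengths_le_add p hseg hm hl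
  linarith [F.dist_le_of_mem hl']

/-- The segment from `z₁` to `z₂` stays in the convex ball around `z`, where every norm is at most
`c` times the one at `z`. -/
theorem exists_dist_le_dist_add_chartNorm [ConnectedSpace X] [FiniteDimensional ℝ E] (p x : X)
    {z₀ : E} {r R : ℝ} (hrR : r < R) (hR : closedBall z₀ R ⊆ (chartAt E p).target) {c : ℝ}
    (hc : 1 < c) :
    ∃ δ > 0, r + δ ≤ R ∧ ∀ z ∈ closedBall z₀ r, ∀ z₁ ∈ ball z δ, ∀ z₂ ∈ ball z δ,
      F.dist x ((chartAt E p).symm z₂) ≤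
        F.dist x ((chartAt E p).symm z₁) + c * F.chartNorm p z (z₂ - z₁) := by
  obtain ⟨δ, hδ, h⟩ := (F.isNormFamilyOn_chartNorm p (isCompact_closedBall z₀ R)
    hR).exists_forall_le_mul hc
  refine ⟨min δ (R - r), lt_min hδ (sub_pos.2 hrR), by linarith [min_le_right δ (R - r)], ?_⟩
  intro z hz z₁ hz₁ z₂ hz₂
  have hsub : ball z (min δ (R - r)) ⊆ closedBall z₀ R := fun u hu => by
    have h1 := (mem_ball.1 hu).trans_le (min_le_right _ _)
    have h2 := dist_triangle u z z₀
    have h3 := mem_closedBall.1 hz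
    exact mem_closedBall.2 (by linarith)
  have hseg : ∀ t ∈ Icc (0 : ℝ) 1, z₁ + t • (z₂ - z₁) ∈ ball z (min δ (R - r)) := fun t ht =>
    (convex_ball z _).add_smul_sub_mem hz₁ hz₂ ht
  refine F.dist_le_dist_add p x (fun t ht => hR (hsub (hseg t ht))) fun t ht => ?_
  exact h z (closedBall_subset_closedBall hrR.le hz) _ (hsub (hseg t ht))
    ((mem_ball.1 (hseg t ht)).trans_le (min_le_left _ _)) _

end FinslerStructure

/-! ### Mollification in a vector space. -/

section Mollification

variable {E : Type*} [NormedAddCommGroup E] [NormedSpace ℝ E] [FiniteDimensional ℝ E]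

/-- Mollification of a function whose increments are locally dominated by a family of norms. -/
theorem exists_contDiff_approx {h : E → ℝ} {N : E → E → ℝ} {z₀ : E} {r δ η B : ℝ}
    (hδ : 0 < δ) (hη : 0 < η) (hN : IsNormFamilyOn N (closedBall z₀ r)) (hB : ∀ z, |h z| ≤ B)
    (hh : ∀ z ∈ closedBall z₀ r, ∀ z₁ ∈ ball z δ, ∀ z₂ ∈ ball z δ,
      h z₂ - h z₁ ≤ N z (z₂ - z₁)) :
    ∃ k : E → ℝ, ContDiff ℝ ∞ k ∧ ∀ z ∈ closedBall z₀ r,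
      |k z - h z| ≤ η ∧ ∀ v, fderiv ℝ k z v ≤ N z v := by
  let _ : MeasurableSpace E := borel E
  have : BorelSpace E := ⟨rfl⟩
  obtain ⟨M, hM0, hM⟩ := hN.exists_le_mul_norm
  have hLip : ∀ z ∈ closedBall z₀ r, ∀ z₁ ∈ ball z δ, ∀ z₂ ∈ ball z δ,
      dist (h z₂) (h z₁) ≤ M * dist z₂ z₁ := fun z hz z₁ h1 z₂ h2 => by
    rw [Real.dist_eq, dist_eq_norm, abs_sub_le_iff]
    refine ⟨(hh z hz z₁ h1 z₂ h2).trans (hM z hz _), ?_⟩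
    rw [norm_sub_rev]
    exact (hh z hz z₂ h2 z₁ h1).trans (hM z hz _)
  set S : Set E := ⋃ z ∈ closedBall z₀ r, ball z δ with hS
  have hSo : IsOpen S := isOpen_biUnion fun _ _ => isOpen_ball
  have hmemS : ∀ z ∈ closedBall z₀ r, ball z δ ⊆ S := fun z hz =>
    subset_biUnion_of_mem (u := fun z => ball z δ) hz
  have hcont : ContinuousOn h S := by
    intro u hu
    obtain ⟨z, hz, huz⟩ := mem_iUnion₂.1 hu
    have hL : LipschitzOnWith M.toNNReal h (ball z δ) := LipschitzOnWith.of_dist_le_mul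
      fun a ha b hb => by
        rw [Real.coe_toNNReal M hM0]
        exact hLip z hz b hb a ha
    exact (hL.continuousOn.continuousAt (isOpen_ball.mem_nhds huz)).continuousWithinAt
  -- Continuity of `h` is known only near the ball, so `h` is cut off there to be locally
  -- integrable.
  set g : E → ℝ := S.indicator h with hg
  set μ : Measure E := Measure.addHaar
  have hgm : AEStronglyMeasurable g μ :=
    (aestronglyMeasurable_indicator_iff hSo.measurableSet).2
      (hcont.aestronglyMeasurable hSo.measurableSet)
  have hgi : LocallyIntegrable g μ := by
    refine (locallyIntegrable_const B).mono hgm (Eventually.of_forall fun z => ?_)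
    have hB0 : 0 ≤ B := (abs_nonneg _).trans (hB z)
    rw [Real.norm_eq_abs, Real.norm_eq_abs, abs_of_nonneg hB0]
    by_cases hz : z ∈ S
    · simpa [hg, hz] using hB z
    · simpa [hg, hz] using hB0
  -- `δ / 2` leaves room for a further shift `s • v` inside `ball z δ`; `M * ρ ≤ η` controls the
  -- uniform error.
  set ρ : ℝ := min (δ / 2) (η / (M + 1)) with hρ
  have hρ0 : 0 < ρ := lt_min (by positivity) (by positivity)
  have hρδ : ρ ≤ δ / 2 := min_le_left _ _
  have hρη : M * ρ ≤ η := by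
    have h1 : ρ ≤ η / (M + 1) := min_le_right _ _
    rw [le_div_iff₀ (by positivity)] at h1
    nlinarith
  let φ : ContDiffBump (0 : E) := ⟨ρ / 2, ρ, by positivity, by linarith⟩
  have hφs : HasCompactSupport (φ.normed μ) := φ.hasCompactSupport_normed
  have hφc : ContDiff ℝ ∞ (φ.normed μ) := φ.contDiff_normed
  set L := ContinuousLinearMap.lsmul ℝ ℝ (E := ℝ)
  set k : E → ℝ := convolution (φ.normed μ) g L μ with hk
  have hks : ContDiff ℝ ∞ k := hφs.contDiff_convolution_left L hφc hgi
  refine ⟨k, hks, fun z hz => ⟨?_, fun v => ?_⟩⟩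
  · have hzz : z ∈ ball z δ := mem_ball_self hδ
    have hgz : g z = h z := indicator_of_mem (hmemS z hz hzz) h
    rw [← Real.dist_eq, ← hgz]
    refine φ.dist_normed_convolution_le hgm fun u hu => ?_
    have hu' : dist u z < ρ := hu
    have huδ : u ∈ ball z δ := mem_ball.2 (by linarith)
    have hgu : g u = h u := indicator_of_mem (hmemS z hz huδ) h
    rw [hgz, hgu]
    exact ((hLip z hz z hzz u huδ).trans (mul_le_mul_of_nonneg_left hu'.le hM0)).trans hρη
  · have hint : ∀ x, Integrable (fun t => φ.normed μ t * g (x - t)) μ := fun x =>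
      hφs.convolutionExists_left L hφc.continuous hgi x
    have hkx : ∀ x, k x = ∫ t, φ.normed μ t * g (x - t) ∂μ := fun x => rfl
    have hd : HasDerivAt (fun s : ℝ => k (z + s • v)) (fderiv ℝ k z v) 0 := by
      have h1 : HasDerivAt (fun s : ℝ => z + s • v) v 0 := by
        simpa using ((hasDerivAt_id (0 : ℝ)).smul_const v).const_add z
      have h2 : HasFDerivAt k (fderiv ℝ k z) (z + (0 : ℝ) • v) := by
        simpa using ((hks.differentiable (by simp)) z).hasFDerivAt
      exact h2.comp_hasDerivAt 0 h1
    -- Only right difference quotients are used, since `N z` is homogeneous only for nonnegative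
    -- factors.
    refine le_of_tendsto hd.tendsto_slope_zero_right ?_
    have hsmall : ∀ᶠ s : ℝ in 𝓝[>] 0, ‖s • v‖ < δ / 2 := by
      have : Tendsto (fun s : ℝ => ‖s • v‖) (𝓝 0) (𝓝 ‖(0 : ℝ) • v‖) :=
        Continuous.tendsto (by fun_prop) 0
      rw [zero_smul, norm_zero] at this
      exact (this.mono_left nhdsWithin_le_nhds).eventually_lt_const (by positivity)
    filter_upwards [hsmall, self_mem_nhdsWithin] with s hs hs0
    have hs0' : 0 < s := hs0
    rw [smul_eq_mul, inv_mul_le_iff₀ hs0']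
    simp only [zero_add, zero_smul, add_zero]
    rw [hkx, hkx, ← integral_sub (hint _) (hint _)]
    -- The kernel has mass one, so the bound is its own average and the integrands can be compared
    -- pointwise.
    have hone : ∫ t, φ.normed μ t * (s * N z v) ∂μ = s * N z v := by
      rw [integral_mul_const, φ.integral_normed, one_mul]
    rw [← hone]
    refine integral_mono ((hint _).sub (hint _)) (φ.integrable_normed.mul_const _) fun t => ?_
    simp only
    rw [← mul_sub]
    by_cases ht : t ∈ ball (0 : E) ρ
    · refine mul_le_mul_of_nonneg_left ?_ (φ.nonneg_normed t)
      have ht' : ‖t‖ < ρ := mem_ball_zero_iff.1 ht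
      have h1 : z - t ∈ ball z δ := by
        rw [mem_ball, dist_eq_norm, sub_sub_cancel_left, norm_neg]
        linarith
      have h2 : z + s • v - t ∈ ball z δ := by
        rw [mem_ball, dist_eq_norm, show z + s • v - t - z = s • v - t by abel]
        linarith [norm_sub_le (s • v) t]
      rw [hg, indicator_of_mem (hmemS z hz h1), indicator_of_mem (hmemS z hz h2),
        ← hN.smul z hz s hs0'.le]
      simpa using hh z hz _ h1 _ h2
    · have : φ.normed μ t = 0 := by
        by_contra hne
        have hmem : t ∈ Function.support (φ.normed μ) := hne
        rw [φ.support_normed_eq] at hmem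
        exact ht hmem
      simp [this]

end Mollification

/-! ### Gluing local approximations by a partition of unity. -/

namespace FinslerStructure

section DirDeriv

variable {E : Type*} [NormedAddCommGroup E] [NormedSpace ℝ E]
  {X : Type*} [TopologicalSpace X] [ChartedSpace E X]

theorem dirDeriv_eq_of_hasMFDerivAt {f : X → ℝ} {q : X} {L : E →L[ℝ] ℝ}
    (h : HasMFDerivAt 𝓘(ℝ, E) 𝓘(ℝ, ℝ) f q L) (v : E) : dirDeriv f q v = L v :=
  congrArg (fun A : E →L[ℝ] ℝ => A v) h.mfderiv

theorem dirDeriv_congr {f g : X → ℝ} {q : X} (h : f =ᶠ[𝓝 q] g) (v : TangentSpace 𝓘(ℝ, E) q) :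
    dirDeriv f q v = dirDeriv g q v :=
  congrArg (fun A : E →L[ℝ] ℝ => A v) (h.mfderiv_eq (I := 𝓘(ℝ, E)) (I' := 𝓘(ℝ, ℝ)))

theorem dirDeriv_const (c : ℝ) (q : X) (v : TangentSpace 𝓘(ℝ, E) q) :
    dirDeriv (fun _ : X => c) q v = 0 :=
  dirDeriv_eq_of_hasMFDerivAt (E := E) (hasMFDerivAt_const c q) v

theorem dirDeriv_mul {f g : X → ℝ} {q : X} (hf : MDifferentiableAt 𝓘(ℝ, E) 𝓘(ℝ, ℝ) f q)
    (hg : MDifferentiableAt 𝓘(ℝ, E) 𝓘(ℝ, ℝ) g q) (v : TangentSpace 𝓘(ℝ, E) q) :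
    dirDeriv (f * g) q v = f q * dirDeriv g q v + g q * dirDeriv f q v :=
  dirDeriv_eq_of_hasMFDerivAt (hf.hasMFDerivAt.mul hg.hasMFDerivAt) v

theorem dirDeriv_sum {ι : Type*} (s : Finset ι) {f : ι → X → ℝ} {q : X}
    (hf : ∀ i ∈ s, MDifferentiableAt 𝓘(ℝ, E) 𝓘(ℝ, ℝ) (f i) q) (v : TangentSpace 𝓘(ℝ, E) q) :
    dirDeriv (∑ i ∈ s, f i) q v = ∑ i ∈ s, dirDeriv (f i) q v := by
  classical
  suffices h : MDifferentiableAt 𝓘(ℝ, E) 𝓘(ℝ, ℝ) (∑ i ∈ s, f i) q ∧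
      dirDeriv (∑ i ∈ s, f i) q v = ∑ i ∈ s, dirDeriv (f i) q v from h.2
  induction s using Finset.induction_on with
  | empty => exact ⟨mdifferentiableAt_const (c := (0 : ℝ)), dirDeriv_const 0 q v⟩
  | insert a s ha ih =>
    obtain ⟨h1, h2⟩ := ih fun i hi => hf i (Finset.mem_insert_of_mem hi)
    have h3 := hf a (Finset.mem_insert_self a s)
    rw [Finset.sum_insert ha, Finset.sum_insert ha, ← h2]
    exact ⟨h3.add h1, dirDeriv_eq_of_hasMFDerivAt (h3.hasMFDerivAt.add h1.hasMFDerivAt) v⟩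

end DirDeriv

variable {E : Type*} [NormedAddCommGroup E] [NormedSpace ℝ E]
  {X : Type*} [TopologicalSpace X] [ChartedSpace E X] [IsManifold 𝓘(ℝ, E) ∞ X]
  (F : FinslerStructure E X)

variable {F} in
/-- The differential of a function glued by a partition of unity. -/
theorem dirDeriv_finsum_smul_le {ι : Type*} (ψ : SmoothPartitionOfUnity ι 𝓘(ℝ, E) X univ)
    {u : ι → X → ℝ} {q : X} {g₀ c : ℝ} {C ε ε' : ι → ℝ} {b : ℝ}
    (hu : ∀ i, q ∈ tsupport (ψ i) → MDifferentiableAt 𝓘(ℝ, E) 𝓘(ℝ, ℝ) (u i) q)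
    (hug : ∀ i, q ∈ tsupport (ψ i) → |u i q - g₀| ≤ ε i)
    (huc : ∀ i, q ∈ tsupport (ψ i) → ∀ v, dirDeriv (u i) q v ≤ c * F.toFun q v)
    (hψ : ∀ i v, |dirDeriv (ψ i) q v| ≤ C i * F.toFun q v)
    (hε : ∀ i, 0 ≤ ε i) (hεC : ∀ i, ε i * C i ≤ ε' i) (hb : ∀ s : Finset ι, ∑ i ∈ s, ε' i ≤ b)
    (v : TangentSpace 𝓘(ℝ, E) q) :
    dirDeriv (fun a => ∑ᶠ i, ψ i a • u i a) q v ≤ (c + b) * F.toFun q v := by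
  classical
  -- Closed supports are used because this finite set of indices serves on a whole neighbourhood of
  -- `q`, as differentiation requires.
  set s := ψ.fintsupport q with hs
  have hmem : ∀ i ∈ s, q ∈ tsupport (ψ i) := fun i hi => (ψ.mem_fintsupport_iff q i).1 hi
  have hψd : ∀ i, MDifferentiableAt 𝓘(ℝ, E) 𝓘(ℝ, ℝ) (ψ i) q := fun i =>
    (ψ i).contMDiff.contMDiffAt.mdifferentiableAt (by simp)
  have hev : (fun a => ∑ᶠ i, ψ i a • u i a) =ᶠ[𝓝 q] ∑ i ∈ s, (ψ i : X → ℝ) * u i := by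
    filter_upwards [ψ.eventually_finsupport_subset q] with a ha
    rw [Finset.sum_apply, finsum_eq_sum_of_support_subset]
    · rfl
    · intro i hi
      refine ha ((ψ.mem_finsupport a).2 fun h0 => hi ?_)
      simp [show ψ i a = 0 from h0]
  have hone : (∑ i ∈ s, (ψ i : X → ℝ)) =ᶠ[𝓝 q] fun _ => (1 : ℝ) := by
    filter_upwards [ψ.eventually_finsupport_subset q] with a ha
    rw [Finset.sum_apply]
    exact ψ.sum_finsupport' a (mem_univ a) ha
  -- This allows `g₀` to be subtracted from every `u i q` below.
  have hzero : ∑ i ∈ s, dirDeriv (ψ i) q v = 0 := by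
    rw [← dirDeriv_sum s fun i _ => hψd i, dirDeriv_congr hone, dirDeriv_const]
  have hsum : ∑ i ∈ s, ψ i q = 1 :=
    ψ.sum_finsupport' q (mem_univ q) (ψ.finsupport_subset_fintsupport q)
  rw [dirDeriv_congr hev, dirDeriv_sum s fun i hi => (hψd i).mul (hu i (hmem i hi))]
  have hFv := F.toFun_nonneg q v
  calc ∑ i ∈ s, dirDeriv ((ψ i : X → ℝ) * u i) q v
      = ∑ i ∈ s, (ψ i q * dirDeriv (u i) q v + (u i q - g₀) * dirDeriv (ψ i) q v) := by
        have h0 : ∑ i ∈ s, g₀ * dirDeriv (ψ i) q v = 0 := by rw [← Finset.mul_sum, hzero, mul_zero]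
        rw [← sub_zero (∑ i ∈ s, dirDeriv ((ψ i : X → ℝ) * u i) q v), ← h0,
          ← Finset.sum_sub_distrib]
        refine Finset.sum_congr rfl fun i hi => ?_
        rw [dirDeriv_mul (hψd i) (hu i (hmem i hi))]
        ring
    _ ≤ ∑ i ∈ s, (ψ i q * (c * F.toFun q v) + ε' i * F.toFun q v) := by
        refine Finset.sum_le_sum fun i hi => add_le_add
          (mul_le_mul_of_nonneg_left (huc i (hmem i hi) v) (ψ.nonneg i q)) ?_
        refine (le_abs_self _).trans ?_
        rw [abs_mul]
        refine (mul_le_mul (hug i (hmem i hi)) (hψ i v) (abs_nonneg _) (hε i)).trans ?_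
        rw [← mul_assoc]
        exact mul_le_mul_of_nonneg_right (hεC i) hFv
    _ = (∑ i ∈ s, ψ i q) * (c * F.toFun q v) + (∑ i ∈ s, ε' i) * F.toFun q v := by
        rw [Finset.sum_add_distrib, Finset.sum_mul, Finset.sum_mul]
    _ ≤ (c + b) * F.toFun q v := by
        rw [hsum, one_mul, add_mul]
        exact add_le_add_right (mul_le_mul_of_nonneg_right (hb s) hFv) _

variable [FiniteDimensional ℝ E]

/-- Smooth functions supported in a small chart ball have differential dominated by a multiple
of `F`. -/
theorem exists_dirDeriv_le_mul (p : X) {r : ℝ}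
    (hr : closedBall (chartAt E p p) r ⊆ (chartAt E p).target) {ψ : X → ℝ}
    (hψ : ContMDiff 𝓘(ℝ, E) 𝓘(ℝ, ℝ) ∞ ψ)
    (hsupp : tsupport ψ ⊆ (chartAt E p).source ∩ chartAt E p ⁻¹' ball (chartAt E p p) r) :
    ∃ C, 0 ≤ C ∧ ∀ q v, |dirDeriv ψ q v| ≤ C * F.toFun q v := by
  set e := chartAt E p with he
  have hN := F.isNormFamilyOn_chartNorm p (isCompact_closedBall (e p) r) hr
  obtain ⟨m, hm, hml⟩ := hN.exists_mul_norm_le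
  have hsm : ContDiffOn ℝ ∞ (ψ ∘ e.symm) e.target :=
    (hψ.comp_contMDiffOn (contMDiffOn_chart_symm (n := ∞))).contDiffOn
  have hfd : ContinuousOn (fderiv ℝ (ψ ∘ e.symm)) e.target :=
    hsm.continuousOn_fderiv_of_isOpen e.open_target (by norm_cast)
  obtain ⟨D, hD⟩ := (isCompact_closedBall (e p) r).exists_bound_of_continuousOn (hfd.mono hr)
  -- `D` bounds the differential for the norm of `E`, and `m` compares that norm with `F`.
  refine ⟨max D 0 / m, by positivity, fun q v => ?_⟩
  by_cases hq : q ∈ tsupport ψ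
  · obtain ⟨hqs, hqb⟩ := hsupp hq
    have hev : ψ =ᶠ[𝓝 q] (ψ ∘ e.symm) ∘ e := by
      filter_upwards [e.open_source.mem_nhds hqs] with a ha
      simp [e.left_inv ha]
    have hdiff : DifferentiableAt ℝ (ψ ∘ e.symm) (e q) :=
      (hsm.contDiffAt (e.open_target.mem_nhds (e.map_source hqs))).differentiableAt (by simp)
    rw [dirDeriv_congr hev, dirDeriv_comp_chartAt p hqs hdiff, ← F.chartNorm_mfderiv p hqs v]
    set w : E := mfderiv 𝓘(ℝ, E) 𝓘(ℝ, E) (chartAt E p) q v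
    have h1 : |fderiv ℝ (ψ ∘ e.symm) (e q) w| ≤ max D 0 * ‖w‖ :=
      (ContinuousLinearMap.le_opNorm _ w).trans (mul_le_mul_of_nonneg_right
        ((hD _ (ball_subset_closedBall hqb)).trans (le_max_left _ _)) (norm_nonneg w))
    have h2 := hml (e q) (ball_subset_closedBall hqb) w
    refine h1.trans ?_
    rw [div_mul_eq_mul_div, le_div_iff₀ hm, mul_assoc, mul_comm ‖w‖]
    exact mul_le_mul_of_nonneg_left h2 (le_max_right _ _)
  · have hev : ψ =ᶠ[𝓝 q] fun _ => (0 : ℝ) := notMem_tsupport_iff_eventuallyEq.1 hq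
    rw [dirDeriv_congr hev, dirDeriv_const, abs_zero]
    exact mul_nonneg (by positivity) (F.toFun_nonneg q v)

/-- Truncating at `1` keeps the increment bound, whose right side is nonnegative, and supplies the
global bound that mollification needs, even off the chart target. -/
theorem exists_local_approx [ConnectedSpace X] (x p : X) {r R : ℝ} (hrR : r < R)
    (hR : closedBall (chartAt E p p) R ⊆ (chartAt E p).target) {c η : ℝ} (hc : 1 < c)
    (hη : 0 < η) :
    ∃ u : X → ℝ, ∀ q ∈ (chartAt E p).source ∩ chartAt E p ⁻¹' ball (chartAt E p p) r,
      ContMDiffAt 𝓘(ℝ, E) 𝓘(ℝ, ℝ) ∞ u q ∧ |u q - min (F.dist x q) 1| ≤ η ∧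
        ∀ v, dirDeriv u q v ≤ c * F.toFun q v := by
  set e := chartAt E p with he
  have hc0 : 0 < c := zero_lt_one.trans hc
  obtain ⟨δ, hδ, hδR, h⟩ := F.exists_dist_le_dist_add_chartNorm p x hrR hR hc
  have hN : IsNormFamilyOn (fun z v => c * F.chartNorm p z v) (closedBall (e p) r) := by
    have h0 := F.isNormFamilyOn_chartNorm p (isCompact_closedBall (e p) r)
      ((closedBall_subset_closedBall hrR.le).trans hR)
    exact ⟨h0.isCompact, h0.continuousOn.const_mul c,
      fun z hz a ha v => by simp only [h0.smul z hz a ha v]; ring,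
      fun z hz v hv => mul_pos hc0 (h0.pos z hz v hv)⟩
  obtain ⟨k, hk, hkz⟩ := exists_contDiff_approx (h := fun z => min (F.dist x (e.symm z)) 1)
    (B := 1) hδ hη hN
    (fun z => by
      rw [abs_of_nonneg (le_min (F.dist_nonneg _ _) zero_le_one)]
      exact min_le_right _ _)
    (fun z hz z₁ h1 z₂ h2 => by
      have h3 := h z hz z₁ h1 z₂ h2
      have h4 : 0 ≤ c * F.chartNorm p z (z₂ - z₁) :=
        mul_nonneg hc0.le (F.chartNorm_nonneg _ _ _)
      rw [sub_le_iff_le_add', ← min_add_add_right]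
      exact min_le_min h3 (by linarith))
  refine ⟨k ∘ e, fun q ⟨hqs, hqb⟩ => ?_⟩
  obtain ⟨h1, h2⟩ := hkz (e q) (ball_subset_closedBall hqb)
  refine ⟨?_, ?_, fun v => ?_⟩
  · exact hk.contMDiff.contMDiffAt.comp q
      ((contMDiffOn_chart (n := ∞)).contMDiffAt (e.open_source.mem_nhds hqs))
  · simpa only [Function.comp, e.left_inv hqs] using h1
  · rw [dirDeriv_comp_chartAt p hqs ((hk.differentiable (by simp)) _),
      ← F.chartNorm_mfderiv p hqs v]
    exact h2 _

/-- Smooth approximation of the truncated distance to a point. -/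
theorem exists_contMDiff_approx [ConnectedSpace X] [T2Space X] [SecondCountableTopology X] (x : X)
    {η : ℝ} (hη : 0 < η) :
    ∃ f : X → ℝ, ContMDiff 𝓘(ℝ, E) 𝓘(ℝ, ℝ) ∞ f ∧ (∀ q, |f q - min (F.dist x q) 1| ≤ η) ∧
      ∀ q v, dirDeriv f q v ≤ (1 + 2 * η) * F.toFun q v := by
  classical
  have : LocallyCompactSpace X := ChartedSpace.locallyCompactSpace E X
  have hball : ∀ p : X, ∃ R > 0, closedBall (chartAt E p p) R ⊆ (chartAt E p).target := fun p =>
    nhds_basis_closedBall.mem_iff.1 ((chartAt E p).open_target.mem_nhds (mem_chart_target E p))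
  choose R hR0 hR using hball
  set U : X → Set X := fun p =>
    (chartAt E p).source ∩ chartAt E p ⁻¹' ball (chartAt E p p) (R p / 2) with hU
  have hUo : ∀ p, IsOpen (U p) := fun p =>
    (chartAt E p).isOpen_inter_preimage isOpen_ball
  have hpU : ∀ p, p ∈ U p := fun p =>
    ⟨mem_chart_source E p, mem_ball_self (half_pos (hR0 p))⟩
  obtain ⟨S, hSc, hSU⟩ := TopologicalSpace.countable_cover_nhds fun p =>
    (hUo p).mem_nhds (hpU p)
  have : Countable S := hSc.to_subtype
  let _ : Encodable S := Encodable.ofCountable S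
  obtain ⟨ψ, hψ⟩ := SmoothPartitionOfUnity.exists_isSubordinate 𝓘(ℝ, E) isClosed_univ
    (fun i : S => U i) (fun i => hUo i) (by rw [← hSU, biUnion_eq_iUnion])
  have hC : ∀ i : S, ∃ C, 0 ≤ C ∧ ∀ q v, |dirDeriv (ψ i) q v| ≤ C * F.toFun q v := fun i =>
    F.exists_dirDeriv_le_mul (i : X)
      ((closedBall_subset_closedBall (half_le_self (hR0 i).le)).trans (hR i))
      (ψ i).contMDiff (hψ i)
  choose C hC0 hC using hC
  -- Countability of the cover permits positive gluing errors with total at most `η`.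
  obtain ⟨ε', hε'0, s, hs, hsη⟩ := posSumOfEncodable hη S
  have hε'sum : ∀ t : Finset S, ∑ i ∈ t, ε' i ≤ η := fun t =>
    (sum_le_hasSum t (fun i _ => (hε'0 i).le) hs).trans hsη
  -- Dividing by `C i + 1` gives both `ε i * C i ≤ ε' i` and `ε i ≤ ε' i ≤ η`.
  set ε : S → ℝ := fun i => ε' i / (C i + 1) with hε
  have hC1 : ∀ i, 0 < C i + 1 := fun i => by linarith [hC0 i]
  have hε0 : ∀ i, 0 < ε i := fun i => div_pos (hε'0 i) (hC1 i)
  have hεη : ∀ i, ε i ≤ η := fun i =>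
    (div_le_self (hε'0 i).le (by linarith [hC0 i])).trans (by simpa using hε'sum {i})
  have hεC : ∀ i, ε i * C i ≤ ε' i := fun i => by
    rw [hε]
    simp only
    rw [div_mul_eq_mul_div, div_le_iff₀ (hC1 i)]
    exact mul_le_mul_of_nonneg_left (by linarith) (hε'0 i).le
  have hu : ∀ i : S, ∃ u : X → ℝ, ∀ q ∈ U i, ContMDiffAt 𝓘(ℝ, E) 𝓘(ℝ, ℝ) ∞ u q ∧
      |u q - min (F.dist x q) 1| ≤ ε i ∧ ∀ v, dirDeriv u q v ≤ (1 + η) * F.toFun q v := fun i =>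
    F.exists_local_approx x (i : X) (half_lt_self (hR0 i)) (hR i) (by linarith) (hε0 i)
  choose u hu using hu
  refine ⟨fun a => ∑ᶠ i, ψ i a • u i a, ?_, fun q => ?_, fun q v => ?_⟩
  · exact ψ.contMDiff_finsum_smul (n := ⊤) fun i q hq => (hu i q (hψ i hq)).1
  · have h := ψ.finsum_smul_mem_convex (g := u) (x := q) (mem_univ q)
      (t := closedBall (min (F.dist x q) 1) η) (fun i hi => ?_) (convex_closedBall _ _)
    · rwa [mem_closedBall, Real.dist_eq] at h
    · rw [mem_closedBall, Real.dist_eq]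
      exact (hu i q (hψ i (subset_tsupport _ hi))).2.1.trans (hεη i)
  · have h := dirDeriv_finsum_smul_le (F := F) ψ (c := 1 + η) (b := η) (ε := ε)
      (fun i hi => (hu i q (hψ i hi)).1.mdifferentiableAt (by simp))
      (fun i hi => (hu i q (hψ i hi)).2.1) (fun i hi => (hu i q (hψ i hi)).2.2)
      (fun i v => hC i q v) (fun i => (hε0 i).le) hεC hε'sum v
    rwa [show 1 + 2 * η = 1 + η + η by ring]

end FinslerStructure

/-! ### The semi-Lipschitz constant. -/

section SemiLipschitz

variable {X : Type*} {d : X → X → ℝ}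

theorem semiLipschitzWith_iff_sub_le (hd : ∀ x y, 0 ≤ d x y) {L : ℝ} (hL : 0 ≤ L) {f : X → ℝ} :
    SemiLipschitzWith d L f ↔ ∀ x y, f y - f x ≤ L * d x y :=
  forall₂_congr fun x y =>
    ⟨fun h => (le_max_left _ _).trans h, fun h => max_le h (mul_nonneg hL (hd x y))⟩

theorem semiLipConst_nonneg (f : X → ℝ) : 0 ≤ semiLipConst d f :=
  Real.sInf_nonneg fun _ hL => hL.1.le

theorem semiLipConst_le {L : ℝ} (hL : 0 < L) {f : X → ℝ} (hf : SemiLipschitzWith d L f) :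
    semiLipConst d f ≤ L :=
  csInf_le ⟨0, fun _ h => h.1.le⟩ ⟨hL, hf⟩

theorem sub_le_semiLipConst_mul (hd : ∀ x y, 0 ≤ d x y) {f : X → ℝ} (hf : IsSemiLipschitz d f)
    (x y : X) : f y - f x ≤ semiLipConst d f * d x y := by
  obtain ⟨L, hL, hfL⟩ := hf
  have hne : {L : ℝ | 0 < L ∧ SemiLipschitzWith d L f}.Nonempty := by
    -- `L` may be zero, while the infimum runs over positive constants.
    refine ⟨L + 1, by linarith, fun a b => (hfL a b).trans ?_⟩
    exact mul_le_mul_of_nonneg_right (by linarith) (hd a b)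
  rw [semiLipConst, mul_comm, ← smul_eq_mul, ← Real.sInf_smul_of_nonneg (hd x y)]
  refine le_csInf hne.smul_set ?_
  rintro _ ⟨K, ⟨-, hfK⟩, rfl⟩
  simpa [mul_comm] using (le_max_left _ _).trans (hfK x y)

theorem semiLipConst_zero (hd : ∀ x y, 0 ≤ d x y) : semiLipConst d (0 : X → ℝ) = 0 := by
  refine le_antisymm (le_of_forall_pos_le_add fun ε hε => ?_) (semiLipConst_nonneg _)
  rw [zero_add]
  exact semiLipConst_le hε ((semiLipschitzWith_iff_sub_le hd hε.le).2 fun x y => by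
    simpa using mul_nonneg hε.le (hd x y))

end SemiLipschitz

/-! ### Estimates for the functional `δ_y - δ_x`. -/

namespace FinslerStructure

variable {E : Type*} [NormedAddCommGroup E] [NormedSpace ℝ E]
  {X : Type*} [TopologicalSpace X] [ChartedSpace E X] [IsManifold 𝓘(ℝ, E) ∞ X]
  (F : FinslerStructure E X)

theorem eval_sub_eval_apply (x y : X) (f : F.algA) :
    (F.eval y - F.eval x) f = (f : X → ℝ) y - (f : X → ℝ) x := rfl

theorem zero_mem_coneSC : (0 : X → ℝ) ∈ F.coneSC := by
  refine ⟨contMDiff_const, ⟨0, ?_⟩, ⟨0, le_rfl, fun a b => ?_⟩, fun _ => le_rfl⟩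
  · rintro _ ⟨a, rfl⟩
    simp
  · simp [realQuasiDist]

theorem hemiNorm_zero : F.hemiNorm 0 = 0 := by
  rw [hemiNorm, if_pos (by simpa using F.zero_mem_coneSC)]
  simp [supNorm, semiLipConst_zero F.dist_nonneg]

theorem sub_le_mul_dist_of_hemiNorm_le {f : F.algA} {r : ℝ} (hr : 0 ≤ r)
    (h : F.hemiNorm f ≤ ENNReal.ofReal r) (x y : X) :
    (f : X → ℝ) y - (f : X → ℝ) x ≤ r * F.dist x y := by
  rw [hemiNorm] at h
  split_ifs at h with hf
  · rw [ENNReal.ofReal_le_ofReal_iff hr] at h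
    exact (sub_le_semiLipConst_mul F.dist_nonneg hf.2.2.1 x y).trans
      (mul_le_mul_of_nonneg_right ((le_max_right _ _).trans h) (F.dist_nonneg x y))
  · exact absurd h (by simp)

theorem eval_sub_eval_mem_dualCone (x y : X) : F.eval y - F.eval x ∈ F.dualCone := by
  intro f₀ c hc
  obtain ⟨r, hr, hrc⟩ : ∃ r : ℝ, 0 < r ∧
      (F.eval y - F.eval x) f₀ + r * F.dist x y < c := by
    have hd := F.dist_nonneg x y
    -- The `+ 1` covers distance zero and makes the inequality strict.
    refine ⟨(c - (F.eval y - F.eval x) f₀) / (F.dist x y + 1),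
      div_pos (sub_pos.2 hc) (by linarith), ?_⟩
    rw [← lt_sub_iff_add_lt', div_mul_eq_mul_div, div_lt_iff₀ (by linarith)]
    exact mul_lt_mul_of_pos_left (by linarith) (sub_pos.2 hc)
  have hopen : IsOpen[forwardTopology fun f g : F.algA => F.hemiNorm (g - f)]
      {g : F.algA | F.hemiNorm (g - f₀) < ENNReal.ofReal r} :=
    TopologicalSpace.isOpen_generateFrom_of_mem ⟨f₀, _, ENNReal.ofReal_pos.2 hr, rfl⟩
  refine Filter.mem_of_superset (@IsOpen.mem_nhds _
    (forwardTopology fun f g : F.algA => F.hemiNorm (g - f)) f₀ _ hopen ?_) fun g hg => ?_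
  · simpa [hemiNorm_zero] using hr
  · have h := F.sub_le_mul_dist_of_hemiNorm_le hr.le (le_of_lt hg) x y
    have hlin := map_add (F.eval y - F.eval x) f₀ (g - f₀)
    rw [add_sub_cancel, F.eval_sub_eval_apply x y (g - f₀)] at hlin
    change (F.eval y - F.eval x) g < c
    linarith

theorem dualNorm_eval_sub_eval_le (x y : X) :
    F.dualNorm (F.eval y - F.eval x) ≤ ((F.dist x y : ℝ) : EReal) := by
  refine iSup_le fun f => EReal.coe_le_coe_iff.2 ?_
  rw [← one_mul (F.dist x y)]
  exact F.sub_le_mul_dist_of_hemiNorm_le zero_le_one (by simpa using f.2) x y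

/-- The supremum norm and the semi-Lipschitz constant of a function control its hemi-norm. -/
theorem exists_mem_algA_of_bounds {f : X → ℝ} (hf : ContMDiff 𝓘(ℝ, E) 𝓘(ℝ, ℝ) 1 f)
    (h0 : ∀ q, 0 ≤ f q) (h1 : ∀ q, f q ≤ 1) (hL : SemiLipschitzWith F.dist 1 f) :
    ∃ hmem : f ∈ F.algA, F.hemiNorm ⟨f, hmem⟩ ≤ 1 := by
  have habs : ∀ q, |f q| ≤ 1 := fun q => by rw [abs_of_nonneg (h0 q)]; exact h1 q
  have hcone : f ∈ F.coneSC := by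
    refine ⟨hf, ⟨1, ?_⟩, ⟨1, zero_le_one, hL⟩, h0⟩
    rintro _ ⟨q, rfl⟩
    exact habs q
  refine ⟨Submodule.subset_span hcone, ?_⟩
  rw [hemiNorm, if_pos hcone, ENNReal.ofReal_le_one]
  exact max_le (Real.iSup_le habs zero_le_one) (semiLipConst_le one_pos hL)

theorem min_dist_one_le_dualNorm [FiniteDimensional ℝ E] [ConnectedSpace X] [T2Space X]
    [SecondCountableTopology X] (x y : X) :
    ((min (F.dist x y) 1 : ℝ) : EReal) ≤ F.dualNorm (F.eval y - F.eval x) := by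
  refine EReal.ge_of_forall_gt_iff_ge.1 fun a ha => ?_
  set D := min (F.dist x y) 1 with hD
  have haD : a < D := EReal.coe_lt_coe_iff.1 ha
  have hD1 : D ≤ 1 := min_le_right _ _
  -- At the end `g y - g x ≥ (D - 2η) / (1 + 2η) ≥ D - 4η = a`, using `D ≤ 1`.
  set η : ℝ := (D - a) / 4 with hη
  have hη0 : 0 < η := by rw [hη]; linarith
  obtain ⟨f, hfs, hfa, hfd⟩ := F.exists_contMDiff_approx x hη0
  have hk : 0 < 1 + 2 * η := by linarith
  have hfL := (semiLipschitzWith_iff_sub_le F.dist_nonneg hk.le).1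
    (F.semiLipschitzWith_of_mfderiv_le hk.le (hfs.mdifferentiable (by simp)) hfd
      F.pathLengths_nonempty)
  -- From `-η ≤ f ≤ 1 + η`, the shift restores nonnegativity; the divisor normalises both the
  -- supremum and the semi-Lipschitz constant.
  set g : X → ℝ := fun q => (f q + η) / (1 + 2 * η) with hg
  have hgs : ContMDiff 𝓘(ℝ, E) 𝓘(ℝ, ℝ) 1 g :=
    (((contDiff_id.add contDiff_const).div_const (1 + 2 * η)).contMDiff.comp
      (hfs.of_le (by norm_cast)) : _)
  obtain ⟨hmem, hnorm⟩ := F.exists_mem_algA_of_bounds hgs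
    (fun q => by
      have h1 := (abs_le.1 (hfa q)).1
      have h2 : 0 ≤ min (F.dist x q) 1 := le_min (F.dist_nonneg _ _) zero_le_one
      exact div_nonneg (by linarith) hk.le)
    (fun q => by
      have h1 := (abs_le.1 (hfa q)).2
      have h2 : min (F.dist x q) 1 ≤ 1 := min_le_right _ _
      exact (div_le_one hk).2 (by linarith))
    ((semiLipschitzWith_iff_sub_le F.dist_nonneg zero_le_one).2 fun p q => by
      rw [hg, one_mul]
      simp only
      rw [← sub_div, div_le_iff₀ hk]
      linarith [hfL p q])
  refine le_trans (EReal.coe_le_coe_iff.2 ?_)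
    (le_iSup (fun f : {f : F.algA // F.hemiNorm f ≤ 1} =>
      (((F.eval y - F.eval x) f : ℝ) : EReal)) ⟨⟨g, hmem⟩, hnorm⟩)
  change a ≤ g y - g x
  have h1 := (abs_le.1 (hfa y)).1
  have h2 := (abs_le.1 (hfa x)).2
  rw [F.dist_self, min_eq_left zero_le_one] at h2
  rw [hg]
  simp only
  rw [← sub_div, le_div_iff₀ hk]
  have h3 : a = D - 4 * η := by rw [hη]; ring
  rw [h3]
  nlinarith

end FinslerStructure

end Finsler

end

theorem mainTheorem3 {E : Type*} [NormedAddCommGroup E] [NormedSpace ℝ E] [FiniteDimensional ℝ E]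
    {X : Type*} [TopologicalSpace X] [T2Space X] [SecondCountableTopology X] [ConnectedSpace X]
    [ChartedSpace E X] [IsManifold 𝓘(ℝ, E) ∞ X]
    (F : Finsler.FinslerStructure E X) (hF : Finsler.IsForwardComplete F.dist) (x y : X) :
    F.eval y - F.eval x ∈ F.dualCone ∧
      ((min (F.dist x y) 1 : ℝ) : EReal) ≤ F.dualNorm (F.eval y - F.eval x) ∧
      F.dualNorm (F.eval y - F.eval x) ≤ ((F.dist x y : ℝ) : EReal) := by
  exact ⟨F.eval_sub_eval_mem_dualCone x y, F.min_dist_one_le_dualNorm x y,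
    F.dualNorm_eval_sub_eval_le x y⟩
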